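/- Let $V$ be a separable real Banach space, $\alpha\in(\tfrac13,\tfrac12]$, $T\ge 0$, and $\beta_0,\beta_1,\beta_2,\beta_3\ge 0$. Put $\beta^*_k=\max\{\beta_0,\dots,\beta_k\}$ and $\beta^{**}_k=\max\{\beta_1,\dots,\beta_{k+1}\}$ for $k=0,1,2$. For a function $\Phi$ of time write $\Phi_{s,t}=\Phi_t-\Phi_s$. Let $\mathbf W=(W,\mathbb W)$ be an $\alpha$-Hölder nonlinear rough path, that is, $W:[0,T]\times V\to V$ and $\mathbb W:[0,T]^2\times V^2\to V$ satisfy the following. (i) For $s\neq t$ in $[0,T]$, $W_{s,t}$ is three times Fréchet differentiable on $V$, and $$\sum_{k=0}^{3}\ \sup_{s\ne t\in[0,T],\,x\in V}\frac{\|D^kW_{s,t}(x)\|}{|t-s|^{\alpha}(1+\|x\|)^{\beta_k}}<\infty .$$ (ii) For $s\ne t$ in $[0,T]$, $\mathbb W_{s,t}$ is twice Fréchet differentiable on $V^2$ (with norm $\|x_1\|+\|x_2\|$), and $$\sum_{k=0}^{2}\ \sup_{s\ne t\in[0,T],\,(x_1,x_2)\in V^2}\frac{\|D^k\mathbb W_{s,t}(x_1,x_2)\|}{|t-s|^{2\alpha}(1+\|x_1\|)^{\beta^*_k}(1+\|x_2\|)^{\beta^{**}_k}}<\infty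 .$$ (iii) (Chen's relation) For all $s,u,t\in[0,T]$ and $x,y\in V$, $$\mathbb W_{s,t}(x,y)-\mathbb W_{s,u}(x,y)-\mathbb W_{u,t}(x,y)=DW_{u,t}(y)\big(W_{s,u}(x)\big).$$ Let $\xi\in V$. An $\alpha$-Hölder continuous function $Y:[0,T]\to V$ is called a solution of the nonlinear rough differential equation $$Y_t=\xi+\int_0^tW(dr,Y_r),\qquad t\in[0,T],$$ if $Y_0=\xi$, $\ \sup_{s\neq t\in[0,T]}\|Y_{s,t}-W_{s,t}(Y_s)\|/|t-s|^{2\alpha}<\infty$, and the equation holds for every $t\in[0,T]$ with $$\int_0^tW(dr,Y_r)=\lim_{|\pi|\to0}\sum_{k=1}^{m}\Big[W_{t_{k-1},t_k}(Y_{t_{k-1}})+\mathbb W_{t_{k-1},t_k}(Y_{t_{k-1}},Y_{t_{k-1}})\Big],$$ the limit, in the norm of $V$, being over partitions $\pi=(0=t_0<t_1<\dots<t_m=t)$ with mesh $|\pi|$ tending to $0$. Then the equation has at most one solution on $[0,T]$: any two solutions with the same $\xi$ coincide on $[0,T]$. -/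

import Mathlib

open Set

namespace NonlinearRough

variable {E F V : Type*} [NormedAddCommGroup E] [NormedSpace ℝ E]
  [NormedAddCommGroup F] [NormedSpace ℝ F] [NormedAddCommGroup V] [NormedSpace ℝ V]

/-- `f` is `n` times Fréchet differentiable on the whole space (the `n`-th derivative need not be
continuous). -/
def TimesDifferentiable (n : ℕ) (f : E → F) : Prop :=
  ∀ k < n, Differentiable ℝ (iteratedFDeriv ℝ k f)

/-- One-parameter `α`-Hölder functions on `[0,T]`: the seminorm
`sup_{s ≠ t} ‖Y t - Y s‖ / |t - s|^α` over `s, t ∈ [0,T]` is finite. Only the values on `[0,T]`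
matter. -/
def HolderPath (T α : ℝ) (Y : ℝ → F) : Prop :=
  ∃ C : ℝ, ∀ s ∈ Icc 0 T, ∀ t ∈ Icc 0 T, s ≠ t → ‖Y t - Y s‖ ≤ C * |t - s| ^ α

/-- Two-parameter `α`-Hölder functions on `[0,T]²`: the seminorm
`sup_{s ≠ t} ‖R s t‖ / |t - s|^α` is finite. -/
def HolderPath₂ (T α : ℝ) (R : ℝ → ℝ → F) : Prop :=
  ∃ C : ℝ, ∀ s ∈ Icc 0 T, ∀ t ∈ Icc 0 T, s ≠ t → ‖R s t‖ ≤ C * |t - s| ^ α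

/-- The increment `Φ_{s,t}(x) = Φ_t(x) - Φ_s(x)` of a function on `[0,T] × V`. -/
def incr (Φ : ℝ → E → F) (s t : ℝ) (x : E) : F := Φ t x - Φ s x

/-- The space `C^{α,β_n}([0,T] × V; F)` with `β_n = (β 0, …, β n)`: the increments are `n` times
differentiable in space, and for every `k ≤ n`
`sup_{s ≠ t, x} ‖D^k Φ_{s,t}(x)‖ / (|t - s|^α (1 + ‖x‖)^(β k))` is finite.
Entries `β k` with `k > n` are not used. -/
def HolderField (T α : ℝ) (n : ℕ) (β : ℕ → ℝ) (Φ : ℝ → V → F) : Prop :=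
  (∀ s ∈ Icc 0 T, ∀ t ∈ Icc 0 T, s ≠ t → TimesDifferentiable n (incr Φ s t)) ∧
  ∃ C : ℝ, ∀ k ≤ n, ∀ s ∈ Icc 0 T, ∀ t ∈ Icc 0 T, s ≠ t → ∀ x : V,
    ‖iteratedFDeriv ℝ k (incr Φ s t) x‖ ≤ C * (|t - s| ^ α * (1 + ‖x‖) ^ β k)

/-- `Ψ_{s,t}` as a function on `V²`, where `V²` carries the norm `‖x₁‖ + ‖x₂‖`. -/
def onProd (Ψ : ℝ → ℝ → V → V → F) (s t : ℝ) (x : WithLp 1 (V × V)) : F :=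
  Ψ s t x.fst x.snd

/-- The space `C₂^{α,β¹_n,β²_n}([0,T]² × V²; F)`: `Ψ_{s,t}` is `n` times differentiable on `V²`, and
for every `k ≤ n`
`sup ‖D^k Ψ_{s,t}(x₁,x₂)‖ / (|t - s|^α (1 + ‖x₁‖)^(β₁ k) (1 + ‖x₂‖)^(β₂ k))` is finite. -/
def HolderField₂ (T α : ℝ) (n : ℕ) (β₁ β₂ : ℕ → ℝ) (Ψ : ℝ → ℝ → V → V → F) : Prop :=
  (∀ s ∈ Icc 0 T, ∀ t ∈ Icc 0 T, s ≠ t → TimesDifferentiable n (onProd Ψ s t)) ∧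
  ∃ C : ℝ, ∀ k ≤ n, ∀ s ∈ Icc 0 T, ∀ t ∈ Icc 0 T, s ≠ t → ∀ x : WithLp 1 (V × V),
    ‖iteratedFDeriv ℝ k (onProd Ψ s t) x‖
      ≤ C * (|t - s| ^ α * (1 + ‖x.fst‖) ^ β₁ k * (1 + ‖x.snd‖) ^ β₂ k)

/-- `β*_k = max {β 0, …, β k}`. -/
noncomputable def betaStar (β : ℕ → ℝ) (k : ℕ) : ℝ := partialSups β k

/-- `β**_k = max {β 1, …, β (k+1)}`. -/
noncomputable def betaStarStar (β : ℕ → ℝ) (k : ℕ) : ℝ := partialSups (fun j => β (j + 1)) k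

/-- `(W, WW)` is an `α`-Hölder nonlinear rough path of class `𝒞^{α,β_n}([0,T] × V; V)`, `n ≥ 1`.
In Chen's relation `D W_{u,t}(y)` is the Fréchet derivative at `y` of the increment `W_{u,t}`. -/
structure IsNonlinearRoughPath (T α : ℝ) (n : ℕ) (β : ℕ → ℝ)
    (W : ℝ → V → V) (WW : ℝ → ℝ → V → V → V) : Prop where
  one_le : 1 ≤ n
  first_level : HolderField T α n β W
  second_level : HolderField₂ T (2 * α) (n - 1) (betaStar β) (betaStarStar β) WW
  chen : ∀ s ∈ Icc 0 T, ∀ u ∈ Icc 0 T, ∀ t ∈ Icc 0 T, ∀ x y : V,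
    WW s t x y - WW s u x y - WW u t x y = fderiv ℝ (incr W u t) y (incr W s u x)

/-- `(Y, Y')` is a basic nonlinear controlled rough path by `W`: both are `α`-Hölder on `[0,T]` and
the remainder `R_{s,t} = Y_{s,t} - W_{s,t}(Y'_s)` is `2α`-Hölder. -/
structure IsControlled (T α : ℝ) (W : ℝ → V → V) (Y Y' : ℝ → V) : Prop where
  holder : HolderPath T α Y
  holder_deriv : HolderPath T α Y'
  remainder : HolderPath₂ T (2 * α) (fun s t => Y t - Y s - incr W s t (Y' s))

/-- `s = p 0 < p 1 < ⋯ < p m = t`; the values `p k` with `k > m` are irrelevant. -/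
def IsPartition (s t : ℝ) (m : ℕ) (p : ℕ → ℝ) : Prop :=
  p 0 = s ∧ p m = t ∧ ∀ k < m, p k < p (k + 1)

/-- `I` is the limit, as the mesh of the partition `s = p 0 < ⋯ < p m = t` tends to `0`, of
`∑_{k<m} Ξ (p k) (p (k+1))`. -/
def HasSewingLimit (Ξ : ℝ → ℝ → V) (s t : ℝ) (I : V) : Prop :=
  ∀ ε > 0, ∃ δ > 0, ∀ (m : ℕ) (p : ℕ → ℝ), IsPartition s t m p →
    (∀ k < m, p (k + 1) - p k < δ) →
    ‖∑ k ∈ Finset.range m, Ξ (p k) (p (k + 1)) - I‖ < ε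

/-- `∫_s^t W(dr, Y_r)` exists and equals `I`, for `Y` controlled by `W` with Gubinelli derivative
`Y'`: the limit of the compensated sums of `Ξ_{u,v} = W_{u,v}(Y_u) + WW_{u,v}(Y'_u, Y_u)`. -/
def HasNonlinearRoughIntegral (W : ℝ → V → V) (WW : ℝ → ℝ → V → V → V)
    (Y Y' : ℝ → V) (s t : ℝ) (I : V) : Prop :=
  HasSewingLimit (fun u v => incr W u v (Y u) + WW u v (Y' u) (Y u)) s t I

/-- `Y` solves `Y_t = ξ + ∫_0^t W(dr, Y_r)` on `[0,T]`: `(Y, Y)` is controlled by `W`, starts at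
`(ξ, ξ)`, and the equation holds for all `t ∈ [0,T]`. -/
structure IsSolution (T α : ℝ) (W : ℝ → V → V) (WW : ℝ → ℝ → V → V → V) (ξ : V)
    (Y : ℝ → V) : Prop where
  controlled : IsControlled T α W Y Y
  initial : Y 0 = ξ
  equation : ∀ t ∈ Icc 0 T, ∃ I : V, HasNonlinearRoughIntegral W WW Y Y 0 t I ∧ Y t = ξ + I

end NonlinearRough

/-! Both solutions are bounded on `[0,T]`, so the polynomial weights may be replaced by constants on
a ball. On `[a,b]` with `Y a = Z a`, let `N` bound the `α`-Hölder seminorm of `Y - Z` and the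
`2α`-Hölder seminorm of the difference of the remainders (`DifferenceBound`).

By Chen's relation the defect of the germ `W_{s,t}(Y_s) + WW_{s,t}(Y_s,Y_s)` at a midpoint `u` is,
up to sign, a Taylor remainder of `W_{u,t}`, plus `DW_{u,t}(Y_s)` applied to the remainder of `Y`,
plus an increment of `WW_{u,t}` on the diagonal. The defects of `Y` and `Z` therefore differ by `O(N
|t-s|^(3α))` (`norm_germ_defect_sub_le`); this is where three derivatives of `W` and two of `WW`
enter. Since `3α > 1`, the sewing estimate `HasSewingLimit.norm_sub_le` carries this bound over to
the integrals.

The spare factor `|t-s|^α`, together with `‖Y - Z‖ ≤ N (b-a)^α` from the common starting value,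
improves `N` to `C (b-a)^α N`, with `C` independent of `[a,b]`. On intervals of a fixed short length
this halves `N`; iteration forces `Y = Z` there, and finitely many such intervals cover `[0,T]`. -/

set_option maxSynthPendingDepth 3

namespace NonlinearRough

/-! ### Second-difference estimates for differentiable maps. -/

section Calculus

variable {E F : Type*} [NormedAddCommGroup E] [NormedSpace ℝ E]
  [NormedAddCommGroup F] [NormedSpace ℝ F]

theorem TimesDifferentiable.differentiable {n : ℕ} {f : E → F}
    (hf : TimesDifferentiable (n + 1) f) : Differentiable ℝ f := by
  have h := hf 0 n.succ_pos
  rw [iteratedFDeriv_zero_eq_comp] at h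
  exact (LinearIsometryEquiv.comp_differentiable_iff _).1 h

theorem TimesDifferentiable.fderiv {n : ℕ} {f : E → F}
    (hf : TimesDifferentiable (n + 1) f) : TimesDifferentiable n (fderiv ℝ f) := by
  intro k hk
  have h := hf (k + 1) (Nat.succ_lt_succ hk)
  have e : iteratedFDeriv ℝ (k + 1) f = _ := funext fun _ => iteratedFDeriv_succ_eq_comp_right
  rw [e] at h
  exact (LinearIsometryEquiv.comp_differentiable_iff _).1 h

theorem norm_iteratedFDeriv_two (f : E → F) (x : E) :
    ‖iteratedFDeriv ℝ 2 f x‖ = ‖fderiv ℝ (fderiv ℝ f) x‖ := by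
  rw [← norm_iteratedFDeriv_fderiv, norm_iteratedFDeriv_one]

theorem norm_iteratedFDeriv_three (f : E → F) (x : E) :
    ‖iteratedFDeriv ℝ 3 f x‖ = ‖fderiv ℝ (fderiv ℝ (fderiv ℝ f)) x‖ := by
  rw [← norm_iteratedFDeriv_fderiv, norm_iteratedFDeriv_two]

/-- Points at the same parameter on two segments differ by a convex combination of the endpoint
differences, and balls are convex. -/
theorem norm_segment_sub_segment_le {x y x' y' : E} {m θ : ℝ} (hx : ‖x - x'‖ ≤ m)
    (hy : ‖y - y'‖ ≤ m) (hθ : θ ∈ Icc (0 : ℝ) 1) :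
    ‖x + θ • (y - x) - (x' + θ • (y' - x'))‖ ≤ m := by
  have hx' : x - x' ∈ Metric.closedBall (0 : E) m := by simpa using hx
  have hy' : y - y' ∈ Metric.closedBall (0 : E) m := by simpa using hy
  have h := (convex_closedBall (0 : E) m).add_smul_sub_mem hx' hy' hθ
  rw [mem_closedBall_zero_iff] at h
  have e : x + θ • (y - x) - (x' + θ • (y' - x')) = x - x' + θ • (y - y' - (x - x')) := by module
  rwa [e]

theorem hasDerivAt_comp_segment {h : E → F} (hd : Differentiable ℝ h) (x a : E) (θ : ℝ) :
    HasDerivAt (fun θ : ℝ => h (x + θ • a)) (fderiv ℝ h (x + θ • a) a) θ := by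
  have h1 : HasDerivAt (fun θ : ℝ => x + θ • a) a θ := by
    simpa using ((hasDerivAt_id θ).smul_const a).const_add x
  exact (hd _).hasFDerivAt.comp_hasDerivAt θ h1

/-- Four-point estimate for a function with bounded and Lipschitz derivative. -/
theorem norm_four_point_le {S : Set E} (hS : Convex ℝ S) {h : E → F} (hd : Differentiable ℝ h)
    {K₁ K₂ m : ℝ} (hK₁ : ∀ z ∈ S, ‖fderiv ℝ h z‖ ≤ K₁) (hK₂ : 0 ≤ K₂)
    (hL : ∀ z ∈ S, ∀ w ∈ S, ‖fderiv ℝ h z - fderiv ℝ h w‖ ≤ K₂ * ‖z - w‖)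
    {x y x' y' : E} (hx : x ∈ S) (hy : y ∈ S) (hx' : x' ∈ S) (hy' : y' ∈ S)
    (hxm : ‖x - x'‖ ≤ m) (hym : ‖y - y'‖ ≤ m) :
    ‖h y - h x - (h y' - h x')‖ ≤ K₁ * ‖(y - x) - (y' - x')‖ + K₂ * m * ‖y' - x'‖ := by
  -- Both segments are run through with the same parameter, so that their points stay within `m` of
  -- each other.
  have key := norm_image_sub_le_of_norm_deriv_le_segment_01'
    (f := fun θ : ℝ => h (x + θ • (y - x)) - h (x' + θ • (y' - x')))
    (C := K₁ * ‖(y - x) - (y' - x')‖ + K₂ * m * ‖y' - x'‖)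
    (fun θ _ => ((hasDerivAt_comp_segment hd x (y - x) θ).sub
      (hasDerivAt_comp_segment hd x' (y' - x') θ)).hasDerivWithinAt) ?_
  · convert key using 2
    simp only [one_smul, zero_smul, add_zero, add_sub_cancel]
    abel
  · intro θ hθ
    have hθ' := Ico_subset_Icc_self hθ
    have hz := hS.add_smul_sub_mem hx hy hθ'
    have hw := hS.add_smul_sub_mem hx' hy' hθ'
    set z := x + θ • (y - x)
    set w := x' + θ • (y' - x')
    have hzw : ‖z - w‖ ≤ m := norm_segment_sub_segment_le hxm hym hθ'
    have e : fderiv ℝ h z (y - x) - fderiv ℝ h w (y' - x')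
        = fderiv ℝ h z ((y - x) - (y' - x')) + (fderiv ℝ h z - fderiv ℝ h w) (y' - x') := by
      simp only [map_sub, sub_apply]; abel
    rw [e]
    refine (norm_add_le _ _).trans (add_le_add ?_ ?_)
    · exact ContinuousLinearMap.le_of_opNorm_le _ (hK₁ z hz) _
    · exact ContinuousLinearMap.le_of_opNorm_le _
        ((hL z hz w hw).trans (mul_le_mul_of_nonneg_left hzw hK₂)) _

/-- Difference of two first-order Taylor remainders. -/
theorem norm_taylor_sub_taylor_le {S : Set E} (hS : Convex ℝ S) {f : E → F}
    (hf : TimesDifferentiable 3 f) {K m : ℝ}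
    (hK₂ : ∀ z ∈ S, ‖iteratedFDeriv ℝ 2 f z‖ ≤ K) (hK₃ : ∀ z ∈ S, ‖iteratedFDeriv ℝ 3 f z‖ ≤ K)
    {x y x' y' : E} (hx : x ∈ S) (hy : y ∈ S) (hx' : x' ∈ S) (hy' : y' ∈ S)
    (hxm : ‖x - x'‖ ≤ m) (hym : ‖y - y'‖ ≤ m) :
    ‖(f y - f x - fderiv ℝ f x (y - x)) - (f y' - f x' - fderiv ℝ f x' (y' - x'))‖
      ≤ K * (‖(y - x) - (y' - x')‖ * (‖y - x‖ + ‖y' - x'‖) + m * ‖y' - x'‖ ^ 2) := by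
  have hK : 0 ≤ K := (norm_nonneg _).trans (hK₂ x hx)
  have hm : 0 ≤ m := (norm_nonneg _).trans hxm
  have hd := hf.differentiable
  have hd₂ := hf.fderiv.differentiable
  have hd₃ := hf.fderiv.fderiv.differentiable
  have hL₁ : ∀ z ∈ S, ∀ w ∈ S, ‖fderiv ℝ f z - fderiv ℝ f w‖ ≤ K * ‖z - w‖ := fun z hz w hw =>
    hS.norm_image_sub_le_of_norm_fderiv_le (fun v _ => hd₂ v)
      (fun v hv => (norm_iteratedFDeriv_two f v).symm.le.trans (hK₂ v hv)) hw hz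
  have hL₂ : ∀ z ∈ S, ∀ w ∈ S,
      ‖fderiv ℝ (fderiv ℝ f) z - fderiv ℝ (fderiv ℝ f) w‖ ≤ K * ‖z - w‖ := fun z hz w hw =>
    hS.norm_image_sub_le_of_norm_fderiv_le (fun v _ => hd₃ v)
      (fun v hv => (norm_iteratedFDeriv_three f v).symm.le.trans (hK₃ v hv)) hw hz
  have hlin : ∀ (x a : E) (θ : ℝ), HasDerivAt (fun θ : ℝ => θ • fderiv ℝ f x a)
      (fderiv ℝ f x a) θ := fun x a θ => by
    simpa using (hasDerivAt_id θ).smul_const (fderiv ℝ f x a)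
  have key := norm_image_sub_le_of_norm_deriv_le_segment_01'
    (f := fun θ : ℝ => (f (x + θ • (y - x)) - θ • fderiv ℝ f x (y - x))
      - (f (x' + θ • (y' - x')) - θ • fderiv ℝ f x' (y' - x')))
    (C := K * (‖(y - x) - (y' - x')‖ * (‖y - x‖ + ‖y' - x'‖) + m * ‖y' - x'‖ ^ 2))
    (fun θ _ => (((hasDerivAt_comp_segment hd x (y - x) θ).sub (hlin x (y - x) θ)).sub
      ((hasDerivAt_comp_segment hd x' (y' - x') θ).sub (hlin x' (y' - x') θ))).hasDerivWithinAt) ?_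
  · convert key using 2
    simp only [one_smul, zero_smul, add_zero, add_sub_cancel]
    abel
  · intro θ hθ
    have hθ' := Ico_subset_Icc_self hθ
    have hz := hS.add_smul_sub_mem hx hy hθ'
    have hw := hS.add_smul_sub_mem hx' hy' hθ'
    have hzw : ‖x + θ • (y - x) - (x' + θ • (y' - x'))‖ ≤ m :=
      norm_segment_sub_segment_le hxm hym hθ'
    -- The four-point estimate is applied to `fderiv ℝ f` itself, at the two base points and the two
    -- moving points; this uses the third derivative.
    have four := norm_four_point_le hS hd₂
      (fun v hv => (norm_iteratedFDeriv_two f v).symm.le.trans (hK₂ v hv)) hK hL₂ hx hz hx' hw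
      hxm hzw
    have hzx := hL₁ _ hz x hx
    simp only [add_sub_cancel_left, ← smul_sub, norm_smul, Real.norm_eq_abs,
      abs_of_nonneg hθ'.1] at four hzx
    have shrink : ∀ a : ℝ, 0 ≤ a → θ * a ≤ a := fun a ha => mul_le_of_le_one_left ha hθ'.2
    have e : fderiv ℝ f (x + θ • (y - x)) (y - x) - fderiv ℝ f x (y - x)
        - (fderiv ℝ f (x' + θ • (y' - x')) (y' - x') - fderiv ℝ f x' (y' - x'))
        = (fderiv ℝ f (x + θ • (y - x)) - fderiv ℝ f x) ((y - x) - (y' - x'))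
          + (fderiv ℝ f (x + θ • (y - x)) - fderiv ℝ f x
            - (fderiv ℝ f (x' + θ • (y' - x')) - fderiv ℝ f x')) (y' - x') := by
      simp only [map_sub, sub_apply]; abel
    rw [e]
    calc _ ≤ K * ‖y - x‖ * ‖(y - x) - (y' - x')‖
          + (K * ‖(y - x) - (y' - x')‖ + K * m * ‖y' - x'‖) * ‖y' - x'‖ := by
          refine (norm_add_le _ _).trans (add_le_add ?_ ?_)
          · refine ContinuousLinearMap.le_of_opNorm_le _ (hzx.trans ?_) _
            exact mul_le_mul_of_nonneg_left (shrink _ (norm_nonneg _)) hK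
          · refine ContinuousLinearMap.le_of_opNorm_le _ (four.trans (add_le_add ?_ ?_)) _
            · exact mul_le_mul_of_nonneg_left (shrink _ (norm_nonneg _)) hK
            · exact mul_le_mul_of_nonneg_left (shrink _ (norm_nonneg _)) (mul_nonneg hK hm)
      _ = _ := by ring

end Calculus

/-! ### Partitions, restriction of integrals, and the sewing estimate. -/

section Sewing

variable {V : Type*} [NormedAddCommGroup V] {Ξ Ξ' : ℝ → ℝ → V}

theorem IsPartition.append {r s t : ℝ} {m n : ℕ} {p q : ℕ → ℝ} (hp : IsPartition r s m p)
    (hq : IsPartition s t n q) (Ξ : ℝ → ℝ → V) {δ : ℝ} (hpδ : ∀ k < m, p (k + 1) - p k < δ)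
    (hqδ : ∀ k < n, q (k + 1) - q k < δ) :
    ∃ w : ℕ → ℝ, IsPartition r t (m + n) w ∧ (∀ k < m + n, w (k + 1) - w k < δ) ∧
      ∑ k ∈ Finset.range (m + n), Ξ (w k) (w (k + 1))
        = ∑ k ∈ Finset.range m, Ξ (p k) (p (k + 1))
          + ∑ k ∈ Finset.range n, Ξ (q k) (q (k + 1)) := by
  set w : ℕ → ℝ := fun k => if k ≤ m then p k else q (k - m) with hw
  have hwl : ∀ k ≤ m, w k = p k := fun k hk => if_pos hk
  have hwr : ∀ k, w (m + k) = q k := by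
    intro k
    rcases k.eq_zero_or_pos with rfl | hk
    · simp [hw, hp.2.1, hq.1]
    · have : ¬ m + k ≤ m := by omega
      simp [hw, this]
  -- A property of consecutive points passes to the glued partition; it serves for both monotonicity
  -- and mesh.
  have hstep : ∀ P : ℝ → ℝ → Prop, (∀ k < m, P (p k) (p (k + 1))) →
      (∀ k < n, P (q k) (q (k + 1))) → ∀ k < m + n, P (w k) (w (k + 1)) := by
    intro P h₁ h₂ k hk
    rcases lt_or_ge k m with h | h
    · rw [hwl k h.le, hwl (k + 1) h]; exact h₁ k h
    · obtain ⟨j, rfl⟩ := Nat.exists_eq_add_of_le h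
      rw [add_assoc, hwr, hwr]; exact h₂ j (by omega)
  refine ⟨w, ⟨by rw [hwl 0 m.zero_le, hp.1], by rw [hwr, hq.2.1],
    hstep (fun a b => a < b) hp.2.2 hq.2.2⟩, hstep (fun a b => b - a < δ) hpδ hqδ, ?_⟩
  rw [Finset.sum_range_add]
  congr 1
  · refine Finset.sum_congr rfl fun k hk => ?_
    have := Finset.mem_range.1 hk
    rw [hwl k this.le, hwl (k + 1) this]
  · refine Finset.sum_congr rfl fun k _ => ?_
    rw [add_assoc, hwr, hwr]

theorem one_sub_two_rpow_pos {θ : ℝ} (hθ : 1 < θ) :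
    0 < 1 - (2 : ℝ) ^ (1 - θ) := by
  have : (2 : ℝ) ^ (1 - θ) < 1 := Real.rpow_lt_one_of_one_lt_of_neg one_lt_two (by linarith)
  linarith

/-- If the defect of `Ξ` at midpoints is of order `θ > 1`, the sums of `Ξ` along dyadic partitions
are close to `Ξ`. -/
theorem exists_partition_sum_close {a₀ b₀ C θ : ℝ} (hθ : 1 < θ)
    (hΞ : ∀ a b, a₀ ≤ a → a < b → b ≤ b₀ →
      ‖Ξ a b - Ξ a ((a + b) / 2) - Ξ ((a + b) / 2) b‖ ≤ C * (b - a) ^ θ) (hC : 0 ≤ C) {δ : ℝ} :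
    ∀ (n : ℕ) (a b : ℝ), a₀ ≤ a → a < b → b ≤ b₀ → b - a < 2 ^ n * δ →
      ∃ (m : ℕ) (p : ℕ → ℝ), IsPartition a b m p ∧ (∀ k < m, p (k + 1) - p k < δ) ∧
        ‖∑ k ∈ Finset.range m, Ξ (p k) (p (k + 1)) - Ξ a b‖
          ≤ C / (1 - 2 ^ (1 - θ)) * (b - a) ^ θ := by
  have hpos := one_sub_two_rpow_pos hθ
  intro n
  induction n with
  | zero =>
    intro a b _ hab _ hδ
    refine ⟨1, fun k => if k = 0 then a else b, ⟨by simp, by simp, ?_⟩, ?_, ?_⟩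
    · intro k hk
      obtain rfl : k = 0 := by omega
      simpa using hab
    · intro k hk
      obtain rfl : k = 0 := by omega
      simpa using hδ
    · have : 0 ≤ b - a := by linarith
      simpa using by positivity
  | succ n ih =>
    intro a b ha hab hb hδ
    rw [pow_succ] at hδ
    obtain ⟨m, p, hp, hpδ, hpb⟩ := ih a ((a + b) / 2) ha (by linarith) (by linarith) (by linarith)
    obtain ⟨m', q, hq, hqδ, hqb⟩ := ih ((a + b) / 2) b (by linarith) (by linarith) hb (by linarith)
    obtain ⟨w, hw, hwδ, hsum⟩ := hp.append hq Ξ hpδ hqδ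
    refine ⟨m + m', w, hw, hwδ, ?_⟩
    have hmid := hΞ a b ha hab hb
    rw [hsum]
    set A := ∑ k ∈ Finset.range m, Ξ (p k) (p (k + 1))
    set B := ∑ k ∈ Finset.range m', Ξ (q k) (q (k + 1))
    have e₁ : (a + b) / 2 - a = (b - a) / 2 := by ring
    have e₂ : b - (a + b) / 2 = (b - a) / 2 := by ring
    rw [e₁] at hpb
    rw [e₂] at hqb
    have e : A + B - Ξ a b = (A - Ξ a ((a + b) / 2)) + (B - Ξ ((a + b) / 2) b)
        - (Ξ a b - Ξ a ((a + b) / 2) - Ξ ((a + b) / 2) b) := by abel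
    have hhalf : ((b - a) / 2) ^ θ * 2 = (b - a) ^ θ * 2 ^ (1 - θ) := by
      rw [Real.div_rpow (by linarith) zero_le_two, Real.rpow_sub two_pos, Real.rpow_one]
      ring
    rw [e]
    -- The constant `L = C / (1 - 2^(1-θ))` is the fixed point of `L = 2^(1-θ) L + C`: two halves
    -- plus the defect at the midpoint.
    calc _ ≤ C / (1 - 2 ^ (1 - θ)) * ((b - a) / 2) ^ θ
          + C / (1 - 2 ^ (1 - θ)) * ((b - a) / 2) ^ θ + C * (b - a) ^ θ :=
          (norm_sub_le _ _).trans (add_le_add ((norm_add_le _ _).trans (add_le_add hpb hqb)) hmid)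
      _ = C / (1 - 2 ^ (1 - θ)) * (((b - a) / 2) ^ θ * 2) + C * (b - a) ^ θ := by ring
      _ = _ := by rw [hhalf]; field_simp; ring

theorem exists_partition_mesh_lt {a b δ : ℝ} (hab : a ≤ b) (hδ : 0 < δ) :
    ∃ (m : ℕ) (p : ℕ → ℝ), IsPartition a b m p ∧ ∀ k < m, p (k + 1) - p k < δ := by
  rcases hab.eq_or_lt with rfl | hab
  · exact ⟨0, fun _ => a, ⟨rfl, rfl, by simp⟩, by simp⟩
  · obtain ⟨n, hn⟩ := pow_unbounded_of_one_lt ((b - a) / δ) (one_lt_two (α := ℝ))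
    obtain ⟨m, p, hp, hpδ, -⟩ := exists_partition_sum_close (Ξ := fun _ _ => (0 : ℝ)) (a₀ := a)
      (b₀ := b) one_lt_two (C := 0) (by simp) le_rfl n a b le_rfl hab le_rfl
      ((div_lt_iff₀ hδ).1 hn)
    exact ⟨m, p, hp, hpδ⟩

theorem HasSewingLimit.sub {s t : ℝ} {I J : V} (hI : HasSewingLimit Ξ s t I)
    (hJ : HasSewingLimit Ξ' s t J) :
    HasSewingLimit (fun u v => Ξ u v - Ξ' u v) s t (I - J) := by
  intro ε hε
  obtain ⟨δ₁, hδ₁, h₁⟩ := hI (ε / 2) (half_pos hε)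
  obtain ⟨δ₂, hδ₂, h₂⟩ := hJ (ε / 2) (half_pos hε)
  refine ⟨min δ₁ δ₂, lt_min hδ₁ hδ₂, fun m p hp hm => ?_⟩
  have h₁' := h₁ m p hp fun k hk => (hm k hk).trans_le (min_le_left _ _)
  have h₂' := h₂ m p hp fun k hk => (hm k hk).trans_le (min_le_right _ _)
  rw [Finset.sum_sub_distrib, sub_sub_sub_comm]
  linarith [norm_sub_le (∑ k ∈ Finset.range m, Ξ (p k) (p (k + 1)) - I)
    (∑ k ∈ Finset.range m, Ξ' (p k) (p (k + 1)) - J)]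

/-- One fixed fine partition of `[r,s]`, put in front of any fine partition of `[s,t]`, gives a fine
partition of `[r,t]`. Existence of the limit on `[s,t]` is thus a conclusion. -/
theorem HasSewingLimit.restrict {r s t : ℝ} {I J : V} (hrs : r ≤ s)
    (hI : HasSewingLimit Ξ r s I) (hJ : HasSewingLimit Ξ r t J) :
    HasSewingLimit Ξ s t (J - I) := by
  intro ε hε
  obtain ⟨δ₁, hδ₁, h₁⟩ := hI (ε / 2) (half_pos hε)
  obtain ⟨δ₂, hδ₂, h₂⟩ := hJ (ε / 2) (half_pos hε)
  obtain ⟨n, q, hq, hqδ⟩ := exists_partition_mesh_lt hrs (lt_min hδ₁ hδ₂)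
  have h₁' := h₁ n q hq fun k hk => (hqδ k hk).trans_le (min_le_left _ _)
  refine ⟨δ₂, hδ₂, fun m p hp hm => ?_⟩
  obtain ⟨w, hw, hwδ, hsum⟩ :=
    hq.append hp Ξ (fun k hk => (hqδ k hk).trans_le (min_le_right _ _)) hm
  have h₂' := h₂ _ w hw hwδ
  rw [hsum] at h₂'
  have e : ∑ k ∈ Finset.range m, Ξ (p k) (p (k + 1)) - (J - I)
      = (∑ k ∈ Finset.range n, Ξ (q k) (q (k + 1)) + ∑ k ∈ Finset.range m, Ξ (p k) (p (k + 1)) - J)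
        - (∑ k ∈ Finset.range n, Ξ (q k) (q (k + 1)) - I) := by abel
  rw [e]
  exact (norm_sub_le _ _).trans_lt (by linarith)

/-- The quantitative part of the sewing lemma. -/
theorem HasSewingLimit.norm_sub_le {s t C θ : ℝ} {I : V} (hI : HasSewingLimit Ξ s t I)
    (hst : s < t) (hθ : 1 < θ) (hC : 0 ≤ C)
    (hΞ : ∀ a b, s ≤ a → a < b → b ≤ t →
      ‖Ξ a b - Ξ a ((a + b) / 2) - Ξ ((a + b) / 2) b‖ ≤ C * (b - a) ^ θ) :
    ‖I - Ξ s t‖ ≤ C / (1 - 2 ^ (1 - θ)) * (t - s) ^ θ := by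
  refine le_of_forall_pos_le_add fun ε hε => ?_
  -- The limit is given, so it suffices to test it on one dyadic partition of small mesh.
  obtain ⟨δ, hδ, h⟩ := hI ε hε
  obtain ⟨n, hn⟩ := pow_unbounded_of_one_lt ((t - s) / δ) (one_lt_two (α := ℝ))
  obtain ⟨m, p, hp, hpδ, hb⟩ :=
    exists_partition_sum_close hθ hΞ hC n s t le_rfl hst le_rfl ((div_lt_iff₀ hδ).1 hn)
  have h' := h m p hp hpδ
  rw [norm_sub_rev] at h'
  have := norm_add_le (I - ∑ k ∈ Finset.range m, Ξ (p k) (p (k + 1)))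
    (∑ k ∈ Finset.range m, Ξ (p k) (p (k + 1)) - Ξ s t)
  rw [sub_add_sub_cancel] at this
  linarith

end Sewing

/-! ### Uniform constants on bounded sets. -/

section Bounds

variable {E F V : Type*} [NormedAddCommGroup E] [NormedAddCommGroup F] [NormedSpace ℝ F]
  [NormedAddCommGroup V] [NormedSpace ℝ V]

theorem HolderPath₂.exists_bound {T α : ℝ} {R : ℝ → ℝ → E} (h : HolderPath₂ T α R) :
    ∃ C, 0 ≤ C ∧ ∀ s t, 0 ≤ s → s < t → t ≤ T → ‖R s t‖ ≤ C * (t - s) ^ α := by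
  obtain ⟨C, hC⟩ := h
  refine ⟨|C|, abs_nonneg C, fun s t hs hst ht => ?_⟩
  have h := hC s ⟨hs, hst.le.trans ht⟩ t ⟨hs.trans hst.le, ht⟩ hst.ne
  have hpos : 0 < t - s := sub_pos.2 hst
  rw [abs_of_pos hpos] at h
  exact h.trans (mul_le_mul_of_nonneg_right (le_abs_self C) (by positivity))

theorem HolderPath.exists_bound {T α : ℝ} {Y : ℝ → E} (h : HolderPath T α Y) :
    ∃ C, 0 ≤ C ∧ ∀ s t, 0 ≤ s → s < t → t ≤ T → ‖Y t - Y s‖ ≤ C * (t - s) ^ α :=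
  HolderPath₂.exists_bound (R := fun s t => Y t - Y s) h

theorem HolderPath.exists_norm_le {T α : ℝ} (hα : 0 ≤ α) {Y : ℝ → E} (h : HolderPath T α Y) :
    ∃ M, 0 ≤ M ∧ ∀ t ∈ Icc 0 T, ‖Y t‖ ≤ M := by
  obtain ⟨C, hC, hb⟩ := h.exists_bound
  refine ⟨‖Y 0‖ + C * |T| ^ α, by positivity, fun t ht => ?_⟩
  rcases ht.1.eq_or_lt with rfl | h0
  · exact le_add_of_nonneg_right (by positivity)
  · have h1 := hb 0 t le_rfl h0 ht.2
    have h2 : (t - 0) ^ α ≤ |T| ^ α :=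
      Real.rpow_le_rpow (by linarith) (by linarith [ht.2, le_abs_self T]) hα
    have h3 : ‖Y t‖ ≤ ‖Y 0‖ + ‖Y t - Y 0‖ := norm_le_norm_add_norm_sub' _ _
    exact h3.trans (add_le_add le_rfl (h1.trans (mul_le_mul_of_nonneg_left h2 hC)))

/-- The absolute value covers negative exponents as well, so no sign of `β` is needed. -/
theorem one_add_norm_rpow_le (x : E) {R : ℝ} (hx : ‖x‖ ≤ R) (b : ℝ) :
    (1 + ‖x‖) ^ b ≤ (1 + R) ^ |b| := by
  have h := norm_nonneg x
  exact (Real.rpow_le_rpow_of_exponent_le (by linarith) (le_abs_self b)).trans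
    (Real.rpow_le_rpow (by linarith) (by linarith) (abs_nonneg b))

theorem HolderField.exists_bound {T α R : ℝ} {n : ℕ} {β : ℕ → ℝ} {Φ : ℝ → V → F}
    (h : HolderField T α n β Φ) (hR : 0 ≤ R) :
    ∃ K, 0 ≤ K ∧ ∀ s t, 0 ≤ s → s < t → t ≤ T → TimesDifferentiable n (incr Φ s t) ∧
      ∀ k ≤ n, ∀ x, ‖x‖ ≤ R → ‖iteratedFDeriv ℝ k (incr Φ s t) x‖ ≤ K * (t - s) ^ α := by
  obtain ⟨hd, C, hC⟩ := h
  -- The sum dominates the weight of every order, which gives one constant for all derivatives.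
  refine ⟨|C| * ∑ k ∈ Finset.range (n + 1), (1 + R) ^ |β k|, by positivity,
    fun s t hs hst ht => ⟨hd s ⟨hs, hst.le.trans ht⟩ t ⟨hs.trans hst.le, ht⟩ hst.ne,
      fun k hk x hx => ?_⟩⟩
  have h := hC k hk s ⟨hs, hst.le.trans ht⟩ t ⟨hs.trans hst.le, ht⟩ hst.ne x
  have hpos : 0 < t - s := sub_pos.2 hst
  rw [abs_of_pos hpos] at h
  have hsum : (1 + R) ^ |β k| ≤ ∑ k ∈ Finset.range (n + 1), (1 + R) ^ |β k| :=
    Finset.single_le_sum (f := fun k => (1 + R) ^ |β k|) (fun i _ => by positivity)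
      (Finset.mem_range.2 (Nat.lt_succ_of_le hk))
  calc _ ≤ C * ((t - s) ^ α * (1 + ‖x‖) ^ β k) := h
    _ ≤ |C| * ((t - s) ^ α * ∑ k ∈ Finset.range (n + 1), (1 + R) ^ |β k|) := by
        gcongr
        · exact le_abs_self C
        · exact (one_add_norm_rpow_le x hx _).trans hsum
    _ = _ := by ring

theorem HolderField₂.exists_bound {T α R : ℝ} {n : ℕ} {β₁ β₂ : ℕ → ℝ} {Ψ : ℝ → ℝ → V → V → F}
    (h : HolderField₂ T α n β₁ β₂ Ψ) (hR : 0 ≤ R) :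
    ∃ K, 0 ≤ K ∧ ∀ s t, 0 ≤ s → s < t → t ≤ T → TimesDifferentiable n (onProd Ψ s t) ∧
      ∀ k ≤ n, ∀ x, ‖x‖ ≤ R → ‖iteratedFDeriv ℝ k (onProd Ψ s t) x‖ ≤ K * (t - s) ^ α := by
  obtain ⟨hd, C, hC⟩ := h
  refine ⟨|C| * ∑ k ∈ Finset.range (n + 1), (1 + R) ^ |β₁ k| * (1 + R) ^ |β₂ k|, by positivity,
    fun s t hs hst ht => ⟨hd s ⟨hs, hst.le.trans ht⟩ t ⟨hs.trans hst.le, ht⟩ hst.ne,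
      fun k hk x hx => ?_⟩⟩
  have h := hC k hk s ⟨hs, hst.le.trans ht⟩ t ⟨hs.trans hst.le, ht⟩ hst.ne x
  have hpos : 0 < t - s := sub_pos.2 hst
  rw [abs_of_pos hpos] at h
  have hsum : (1 + R) ^ |β₁ k| * (1 + R) ^ |β₂ k|
      ≤ ∑ k ∈ Finset.range (n + 1), (1 + R) ^ |β₁ k| * (1 + R) ^ |β₂ k| :=
    Finset.single_le_sum (f := fun k => (1 + R) ^ |β₁ k| * (1 + R) ^ |β₂ k|)
      (fun i _ => by positivity) (Finset.mem_range.2 (Nat.lt_succ_of_le hk))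
  have hnorm : ‖x‖ = ‖x.fst‖ + ‖x.snd‖ := WithLp.prod_norm_eq_of_L1 x
  have hx₁ : ‖x.fst‖ ≤ R := by linarith [norm_nonneg x.snd]
  have hx₂ : ‖x.snd‖ ≤ R := by linarith [norm_nonneg x.fst]
  calc _ ≤ C * ((t - s) ^ α * (1 + ‖x.fst‖) ^ β₁ k * (1 + ‖x.snd‖) ^ β₂ k) := h
    _ ≤ |C| * ((t - s) ^ α * (1 + R) ^ |β₁ k| * (1 + R) ^ |β₂ k|) := by
        gcongr
        · exact le_abs_self C
        · exact one_add_norm_rpow_le _ hx₁ _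
        · exact one_add_norm_rpow_le _ hx₂ _
    _ = |C| * (t - s) ^ α * ((1 + R) ^ |β₁ k| * (1 + R) ^ |β₂ k|) := by ring
    _ ≤ _ := (mul_le_mul_of_nonneg_left hsum (by positivity)).trans_eq (by ring)

end Bounds

/-! ### Comparison of the germs of two paths. -/

section Germ

variable {V : Type*} [NormedAddCommGroup V]

theorem norm_diag (x : V) : ‖WithLp.toLp 1 (x, x)‖ = 2 * ‖x‖ :=
  (WithLp.prod_norm_eq_of_L1 _).trans (two_mul _).symm

variable [NormedSpace ℝ V]

theorem norm_diag_sub_diag_le {g : WithLp 1 (V × V) → V} (hg : TimesDifferentiable 2 g)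
    {K R : ℝ} (hgK : ∀ k ≤ 2, ∀ z, ‖z‖ ≤ 2 * R → ‖iteratedFDeriv ℝ k g z‖ ≤ K)
    {x x' : V} (hx : ‖x‖ ≤ R) (hx' : ‖x'‖ ≤ R) :
    ‖g (WithLp.toLp 1 (x, x)) - g (WithLp.toLp 1 (x', x'))‖ ≤ K * (2 * ‖x - x'‖) := by
  have mem : ∀ {x : V}, ‖x‖ ≤ R →
      WithLp.toLp 1 (x, x) ∈ Metric.closedBall (0 : WithLp 1 (V × V)) (2 * R) := fun {x} hx => by
    rw [mem_closedBall_zero_iff, norm_diag]; linarith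
  rw [← norm_diag]
  exact (convex_closedBall (0 : WithLp 1 (V × V)) (2 * R)).norm_image_sub_le_of_norm_fderiv_le
    (fun v _ => hg.differentiable v)
    (fun v hv => norm_iteratedFDeriv_one (𝕜 := ℝ) (f := g) (x := v) ▸
      hgK 1 one_le_two v (mem_closedBall_zero_iff.1 hv)) (mem hx') (mem hx)

/-- Difference of the sewing defects of two compensated germs. -/
theorem norm_germ_defect_sub_le {f : V → V} {g : WithLp 1 (V × V) → V}
    (hf : TimesDifferentiable 3 f) (hg : TimesDifferentiable 2 g) {K R ω c N : ℝ} (hK : 0 ≤ K)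
    (hω : 0 ≤ ω)
    (hfK : ∀ k ≤ 3, ∀ z, ‖z‖ ≤ R → ‖iteratedFDeriv ℝ k f z‖ ≤ K * ω)
    (hgK : ∀ k ≤ 2, ∀ z, ‖z‖ ≤ 2 * R → ‖iteratedFDeriv ℝ k g z‖ ≤ K * ω ^ 2)
    {x y x' y' A A' : V} (hx : ‖x‖ ≤ R) (hy : ‖y‖ ≤ R) (hx' : ‖x'‖ ≤ R) (hy' : ‖y'‖ ≤ R)
    (hxy : ‖y - x‖ ≤ c * ω) (hxy' : ‖y' - x'‖ ≤ c * ω) (hA' : ‖y' - x' - A'‖ ≤ c * ω ^ 2)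
    (hxx : ‖x - x'‖ ≤ N) (hyy : ‖y - y'‖ ≤ N) (hinc : ‖(y - x) - (y' - x')‖ ≤ N * ω)
    (hrem : ‖(y - x - A) - (y' - x' - A')‖ ≤ N * ω ^ 2) :
    ‖(f y - f x - fderiv ℝ f x A + (g (WithLp.toLp 1 (y, y)) - g (WithLp.toLp 1 (x, x))))
      - (f y' - f x' - fderiv ℝ f x' A'
        + (g (WithLp.toLp 1 (y', y')) - g (WithLp.toLp 1 (x', x'))))‖
      ≤ K * (c ^ 2 + 7 * c + 3) * N * ω ^ 3 := by
  have hN : 0 ≤ N := (norm_nonneg _).trans hxx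
  have mem : ∀ {x : V}, ‖x‖ ≤ R → x ∈ Metric.closedBall (0 : V) R := fun hx =>
    mem_closedBall_zero_iff.2 hx
  have mem₂ : ∀ {x : V}, ‖x‖ ≤ R →
      WithLp.toLp 1 (x, x) ∈ Metric.closedBall (0 : WithLp 1 (V × V)) (2 * R) := fun {x} hx => by
    rw [mem_closedBall_zero_iff, norm_diag]; linarith
  have hconv := convex_closedBall (0 : V) R
  have hconv₂ := convex_closedBall (0 : WithLp 1 (V × V)) (2 * R)
  have taylor := norm_taylor_sub_taylor_le hconv hf
    (fun z hz => hfK 2 (by norm_num) z (mem_closedBall_zero_iff.1 hz))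
    (fun z hz => hfK 3 le_rfl z (mem_closedBall_zero_iff.1 hz))
    (mem hx) (mem hy) (mem hx') (mem hy') hxx hyy
  have htaylor : ‖(f y - f x - fderiv ℝ f x (y - x)) - (f y' - f x' - fderiv ℝ f x' (y' - x'))‖
      ≤ K * ω * (N * ω * (c * ω + c * ω) + N * (c * ω) ^ 2) :=
    taylor.trans (by gcongr)
  have hderiv : ‖fderiv ℝ f x ((y - x - A) - (y' - x' - A'))
      + (fderiv ℝ f x - fderiv ℝ f x') (y' - x' - A')‖
      ≤ K * ω * (N * ω ^ 2) + K * ω * N * (c * ω ^ 2) := by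
    refine (norm_add_le _ _).trans (add_le_add ?_ ?_)
    · refine (ContinuousLinearMap.le_of_opNorm_le _
        (norm_iteratedFDeriv_one (𝕜 := ℝ) (f := f) (x := x) ▸ hfK 1 (by norm_num) x hx) _).trans ?_
      gcongr
    · refine (ContinuousLinearMap.le_of_opNorm_le _
        (hconv.norm_image_sub_le_of_norm_fderiv_le (fun v _ => hf.fderiv.differentiable v)
          (fun v hv => (norm_iteratedFDeriv_two f v).symm.le.trans
            (hfK 2 (by norm_num) v (mem_closedBall_zero_iff.1 hv))) (mem hx') (mem hx)) _).trans ?_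
      gcongr
  have sub_diag : ∀ x y : V, WithLp.toLp 1 (x, x) - WithLp.toLp 1 (y, y)
      = WithLp.toLp 1 (x - y, x - y) := fun _ _ => rfl
  have four := norm_four_point_le hconv₂ hg.differentiable (K₁ := K * ω ^ 2) (K₂ := K * ω ^ 2)
    (m := 2 * N)
    (fun v hv => norm_iteratedFDeriv_one (𝕜 := ℝ) (f := g) (x := v) ▸
      hgK 1 one_le_two v (mem_closedBall_zero_iff.1 hv)) (by positivity)
    (fun z hz w hw => hconv₂.norm_image_sub_le_of_norm_fderiv_le
      (fun v _ => hg.fderiv.differentiable v)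
      (fun v hv => (norm_iteratedFDeriv_two g v).symm.le.trans
        (hgK 2 le_rfl v (mem_closedBall_zero_iff.1 hv))) hw hz)
    (mem₂ hx) (mem₂ hy) (mem₂ hx') (mem₂ hy')
    (by rw [sub_diag, norm_diag]; linarith) (by rw [sub_diag, norm_diag]; linarith)
  simp only [sub_diag, norm_diag] at four
  have hfour := four.trans (show _ ≤ K * ω ^ 2 * (2 * (N * ω))
    + K * ω ^ 2 * (2 * N) * (2 * (c * ω)) by gcongr)
  -- The increment `A` is exchanged for `y - x` at the cost of the controlled remainder `y - x - A`.
  -- The three groups contribute `c² + 2c`, `1 + c` and `2 + 4c`.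
  have e : (f y - f x - fderiv ℝ f x A + (g (WithLp.toLp 1 (y, y)) - g (WithLp.toLp 1 (x, x))))
      - (f y' - f x' - fderiv ℝ f x' A'
        + (g (WithLp.toLp 1 (y', y')) - g (WithLp.toLp 1 (x', x'))))
      = ((f y - f x - fderiv ℝ f x (y - x)) - (f y' - f x' - fderiv ℝ f x' (y' - x')))
        + (fderiv ℝ f x ((y - x - A) - (y' - x' - A'))
          + (fderiv ℝ f x - fderiv ℝ f x') (y' - x' - A'))
        + (g (WithLp.toLp 1 (y, y)) - g (WithLp.toLp 1 (x, x))
          - (g (WithLp.toLp 1 (y', y')) - g (WithLp.toLp 1 (x', x')))) := by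
    simp only [map_sub, sub_apply]; abel
  rw [e]
  refine (norm_add₃_le.trans (add_le_add (add_le_add htaylor hderiv) hfour)).trans_eq ?_
  ring

end Germ

/-! ### Contraction of the difference of two solutions on short intervals. -/

section Uniqueness

variable {V : Type*} [NormedAddCommGroup V]

/-- On `[a,b]`, the difference of the paths `Y` and `Z` is `α`-Hölder and the difference of their
remainders is `2α`-Hölder, both with constant `N`. -/
def DifferenceBound (α : ℝ) (W : ℝ → V → V) (Y Z : ℝ → V) (a b N : ℝ) : Prop :=
  ∀ s t, a ≤ s → s < t → t ≤ b →
    ‖(Y t - Y s) - (Z t - Z s)‖ ≤ N * (t - s) ^ α ∧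
    ‖(Y t - Y s - incr W s t (Y s)) - (Z t - Z s - incr W s t (Z s))‖ ≤ N * (t - s) ^ (2 * α)

theorem IsControlled.exists_differenceBound {T α : ℝ} {W : ℝ → V → V} {Y Z : ℝ → V}
    (hY : IsControlled T α W Y Y) (hZ : IsControlled T α W Z Z) :
    ∃ N, 0 ≤ N ∧ DifferenceBound α W Y Z 0 T N := by
  obtain ⟨c₁, hc₁, h₁⟩ := hY.holder.exists_bound
  obtain ⟨c₂, hc₂, h₂⟩ := hZ.holder.exists_bound
  obtain ⟨c₃, hc₃, h₃⟩ := hY.remainder.exists_bound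
  obtain ⟨c₄, hc₄, h₄⟩ := hZ.remainder.exists_bound
  refine ⟨c₁ + c₂ + (c₃ + c₄), by positivity, fun s t hs hst ht => ⟨?_, ?_⟩⟩
  · have hp : 0 ≤ (t - s) ^ α := Real.rpow_nonneg (sub_pos.2 hst).le _
    nlinarith [norm_sub_le (Y t - Y s) (Z t - Z s), h₁ s t hs hst ht, h₂ s t hs hst ht,
      mul_nonneg hc₃ hp, mul_nonneg hc₄ hp]
  · have hp : 0 ≤ (t - s) ^ (2 * α) := Real.rpow_nonneg (sub_pos.2 hst).le _
    nlinarith [norm_sub_le (Y t - Y s - incr W s t (Y s)) (Z t - Z s - incr W s t (Z s)),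
      h₃ s t hs hst ht, h₄ s t hs hst ht, mul_nonneg hc₁ hp, mul_nonneg hc₂ hp]

theorem IsSolution.hasSewingLimit {T α : ℝ} {W : ℝ → V → V} {WW : ℝ → ℝ → V → V → V} {ξ : V}
    {Y : ℝ → V} (hY : IsSolution T α W WW ξ Y) {s t : ℝ} (hs : 0 ≤ s) (hst : s ≤ t) (ht : t ≤ T) :
    HasSewingLimit (fun u v => incr W u v (Y u) + WW u v (Y u) (Y u)) s t (Y t - Y s) := by
  obtain ⟨I, hI, hYI⟩ := hY.equation s ⟨hs, hst.trans ht⟩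
  obtain ⟨J, hJ, hYJ⟩ := hY.equation t ⟨hs.trans hst, ht⟩
  have h := HasSewingLimit.restrict hs hI hJ
  rwa [hYI, hYJ, add_sub_add_left_eq_sub]

theorem eq_of_differenceBound_contraction {α : ℝ} {W : ℝ → V → V} {Y Z : ℝ → V} {a b N : ℝ}
    (hN : 0 ≤ N) (ha : Y a = Z a) (h₀ : DifferenceBound α W Y Z a b N)
    (h : ∀ N, 0 ≤ N → DifferenceBound α W Y Z a b N → DifferenceBound α W Y Z a b (1 / 2 * N))
    {t : ℝ} (hat : a ≤ t) (htb : t ≤ b) : Y t = Z t := by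
  rcases hat.eq_or_lt with rfl | hat
  · exact ha
  have hn : ∀ n : ℕ, DifferenceBound α W Y Z a b ((1 / 2) ^ n * N) := by
    intro n
    induction n with
    | zero => simpa using h₀
    | succ n ih =>
      have := h _ (by positivity) ih
      rwa [← mul_assoc, ← pow_succ'] at this
  have hlim : Filter.Tendsto (fun n : ℕ => (1 / 2 : ℝ) ^ n * N * (t - a) ^ α) Filter.atTop
      (nhds (0 * N * (t - a) ^ α)) :=
    ((tendsto_pow_atTop_nhds_zero_of_lt_one (by norm_num) (by norm_num)).mul_const N).mul_const _
  have hle := ge_of_tendsto' hlim fun n => (hn n a t le_rfl hat htb).1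
  rw [ha, sub_sub_sub_cancel_right, zero_mul, zero_mul, norm_le_zero_iff, sub_eq_zero] at hle
  exact hle

theorem DifferenceBound.mono {α : ℝ} {W : ℝ → V → V} {Y Z : ℝ → V} {a b a' b' N N' : ℝ}
    (h : DifferenceBound α W Y Z a b N) (ha : a ≤ a') (hb : b' ≤ b) (hN : N ≤ N') :
    DifferenceBound α W Y Z a' b' N' := fun s t hs hst ht => by
  have h := h s t (ha.trans hs) hst (ht.trans hb)
  have hpos := (sub_pos.2 hst).le
  exact ⟨h.1.trans (mul_le_mul_of_nonneg_right hN (Real.rpow_nonneg hpos _)),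
    h.2.trans (mul_le_mul_of_nonneg_right hN (Real.rpow_nonneg hpos _))⟩

/-- A step size for which a constant `C` times its `α`-th power is at most `1/2`. -/
theorem exists_pos_mul_rpow_le_half {α : ℝ} (hα : 0 < α) (C : ℝ) :
    ∃ h, 0 < h ∧ h ≤ 1 ∧ C * h ^ α ≤ 1 / 2 := by
  have hc : Filter.Tendsto (fun h : ℝ => C * h ^ α) (nhdsWithin 0 (Ioi 0)) (nhds 0) := by
    have : ContinuousAt (fun h : ℝ => C * h ^ α) 0 :=
      continuousAt_const.mul (Real.continuousAt_rpow_const 0 α (Or.inr hα.le))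
    have h := this.tendsto
    rw [Real.zero_rpow hα.ne', mul_zero] at h
    exact h.mono_left nhdsWithin_le_nhds
  obtain ⟨h, h₁, h₂, h₃⟩ := ((hc.eventually (ge_mem_nhds (by norm_num : (0 : ℝ) < 1 / 2))).and
    (Ioc_mem_nhdsGT (zero_lt_one (α := ℝ)))).exists
  exact ⟨h, h₂, h₃, h₁⟩

variable [NormedSpace ℝ V]

/-- Chen's relation expresses the sewing defect of the compensated germ. -/
theorem germ_defect_eq {T α : ℝ} {n : ℕ} {β : ℕ → ℝ} {W : ℝ → V → V} {WW : ℝ → ℝ → V → V → V}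
    (hW : IsNonlinearRoughPath T α n β W WW) (Y : ℝ → V) {s u t : ℝ} (hs : s ∈ Icc 0 T)
    (hu : u ∈ Icc 0 T) (ht : t ∈ Icc 0 T) :
    (incr W s t (Y s) + WW s t (Y s) (Y s)) - (incr W s u (Y s) + WW s u (Y s) (Y s))
        - (incr W u t (Y u) + WW u t (Y u) (Y u))
      = -(incr W u t (Y u) - incr W u t (Y s) - fderiv ℝ (incr W u t) (Y s) (incr W s u (Y s))
        + (onProd WW u t (WithLp.toLp 1 (Y u, Y u)) - onProd WW u t (WithLp.toLp 1 (Y s, Y s)))) := by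
  rw [← hW.chen s hs u hu t ht (Y s) (Y s)]
  have hd : ∀ x, onProd WW u t (WithLp.toLp 1 (x, x)) = WW u t x x := fun _ => rfl
  simp only [incr, hd]
  abel

theorem rpow_mul_eq_pow {x α : ℝ} (hx : 0 ≤ x) (n : ℕ) : x ^ (n * α) = (x ^ α) ^ n := by
  rw [mul_comm, Real.rpow_mul hx, Real.rpow_natCast]

/-- On short intervals the difference of two solutions contracts. -/
theorem exists_differenceBound_contraction {T α : ℝ} (hα : 1 / 3 < α) {β : ℕ → ℝ}
    {W : ℝ → V → V} {WW : ℝ → ℝ → V → V → V} (hW : IsNonlinearRoughPath T α 3 β W WW) {ξ : V}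
    {Y Z : ℝ → V} (hY : IsSolution T α W WW ξ Y) (hZ : IsSolution T α W WW ξ Z) :
    ∃ C, 0 ≤ C ∧ ∀ a b N, 0 ≤ a → b ≤ T → b - a ≤ 1 → 0 ≤ N → Y a = Z a →
      DifferenceBound α W Y Z a b N → DifferenceBound α W Y Z a b (C * (b - a) ^ α * N) := by
  have hα0 : 0 < α := by linarith
  obtain ⟨M₁, hM₁, hYM⟩ := hY.controlled.holder.exists_norm_le hα0.le
  obtain ⟨M₂, hM₂, hZM⟩ := hZ.controlled.holder.exists_norm_le hα0.le
  obtain ⟨c₁, hc₁, hYc⟩ := hY.controlled.holder.exists_bound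
  obtain ⟨c₂, hc₂, hZc⟩ := hZ.controlled.holder.exists_bound
  obtain ⟨c₃, hc₃, hZr⟩ := hZ.controlled.remainder.exists_bound
  set R := M₁ + M₂
  obtain ⟨K₁, hK₁, hWK⟩ := hW.first_level.exists_bound (R := R) (by positivity)
  obtain ⟨K₂, hK₂, hWWK⟩ := hW.second_level.exists_bound (R := 2 * R) (by positivity)
  set K := K₁ + K₂
  set c := c₁ + c₂ + c₃
  have hK : 0 ≤ K := by positivity
  have hθ : 1 < 3 * α := by linarith
  have hq := one_sub_two_rpow_pos hθ
  set q : ℝ := 1 - 2 ^ (1 - 3 * α)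
  have hYR : ∀ t ∈ Icc 0 T, ‖Y t‖ ≤ R := fun t ht => (hYM t ht).trans (by simp [R, hM₂])
  have hZR : ∀ t ∈ Icc 0 T, ‖Z t‖ ≤ R := fun t ht => (hZM t ht).trans (by simp [R, hM₁])
  set D := K * (c ^ 2 + 7 * c + 3)
  have hD : 0 ≤ D := by positivity
  -- `D / q` comes from sewing, `2K` from the difference of the `WW` terms, and the last `K` from
  -- the difference of the `W` terms.
  refine ⟨D / q + 3 * K, by positivity, fun a b N ha hb hab hN hYZa hN₀ => ?_⟩
  have two : ∀ x : ℝ, 0 ≤ x → x ^ (2 * α) = (x ^ α) ^ 2 := fun x hx => by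
    exact_mod_cast rpow_mul_eq_pow hx 2
  have three : ∀ x : ℝ, 0 ≤ x → x ^ (3 * α) = (x ^ α) ^ 3 := fun x hx => by
    exact_mod_cast rpow_mul_eq_pow hx 3
  -- The common value at `a` turns the Hölder bound into a sup bound with the small factor
  -- `(b-a)^α`.
  have hsup : ∀ s, a ≤ s → s ≤ b → ‖Y s - Z s‖ ≤ N * (b - a) ^ α := by
    intro s has hsb
    rcases has.eq_or_lt with rfl | has
    · rw [hYZa, sub_self, norm_zero]
      exact mul_nonneg hN (Real.rpow_nonneg (by linarith) _)
    · have h := (hN₀ a s le_rfl has hsb).1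
      rw [hYZa, sub_sub_sub_cancel_right] at h
      exact h.trans (mul_le_mul_of_nonneg_left
        (Real.rpow_le_rpow (by linarith) (by linarith) hα0.le) hN)
  have hsupN : ∀ s, a ≤ s → s ≤ b → ‖Y s - Z s‖ ≤ N := fun s has hsb =>
    (hsup s has hsb).trans
      (mul_le_of_le_one_right hN (Real.rpow_le_one (by linarith) hab hα0.le))
  have hdefect : ∀ s t, a ≤ s → s < t → t ≤ b →
      ‖((incr W s t (Y s) + WW s t (Y s) (Y s)) - (incr W s t (Z s) + WW s t (Z s) (Z s)))
        - ((incr W s ((s + t) / 2) (Y s) + WW s ((s + t) / 2) (Y s) (Y s))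
          - (incr W s ((s + t) / 2) (Z s) + WW s ((s + t) / 2) (Z s) (Z s)))
        - ((incr W ((s + t) / 2) t (Y ((s + t) / 2))
            + WW ((s + t) / 2) t (Y ((s + t) / 2)) (Y ((s + t) / 2)))
          - (incr W ((s + t) / 2) t (Z ((s + t) / 2))
            + WW ((s + t) / 2) t (Z ((s + t) / 2)) (Z ((s + t) / 2))))‖
      ≤ D * N * (t - s) ^ (3 * α) := by
    intro s t has hst htb
    obtain ⟨u, hu⟩ : ∃ u, u = (s + t) / 2 := ⟨_, rfl⟩
    rw [← hu]
    have hsu : s < u := by linarith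
    have hut : u < t := by linarith
    have hs0 : 0 ≤ s := ha.trans has
    have htT : t ≤ T := htb.trans hb
    have hsm : s ∈ Icc 0 T := ⟨hs0, by linarith⟩
    have hum : u ∈ Icc 0 T := ⟨by linarith, by linarith⟩
    have htm : t ∈ Icc 0 T := ⟨by linarith, htT⟩
    have hω : 0 ≤ (t - s) ^ α := Real.rpow_nonneg (by linarith) _
    have hω₁ : (u - s) ^ α ≤ (t - s) ^ α :=
      Real.rpow_le_rpow (by linarith) (by linarith) hα0.le
    have hω₂ : (t - u) ^ α ≤ (t - s) ^ α :=
      Real.rpow_le_rpow (by linarith) (by linarith) hα0.le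
    have hω₁' : (u - s) ^ (2 * α) ≤ ((t - s) ^ α) ^ 2 := by
      rw [← two _ (by linarith)]
      exact Real.rpow_le_rpow (by linarith) (by linarith) (by linarith)
    have hω₂' : (t - u) ^ (2 * α) ≤ ((t - s) ^ α) ^ 2 := by
      rw [← two _ (by linarith)]
      exact Real.rpow_le_rpow (by linarith) (by linarith) (by linarith)
    obtain ⟨hf, hfK⟩ := hWK u t hum.1 hut htT
    obtain ⟨hg, hgK⟩ := hWWK u t hum.1 hut htT
    have hinc := hN₀ s u has hsu (by linarith)
    have key := norm_germ_defect_sub_le hf hg (K := K) (R := R) (c := c) (N := N) hK hω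
      (fun k hk z hz => (hfK k hk z hz).trans
        (mul_le_mul (by simp [K, hK₂]) hω₂ (Real.rpow_nonneg (by linarith) _) hK))
      (fun k hk z hz => (hgK k hk z hz).trans
        (mul_le_mul (by simp [K, hK₁]) hω₂' (Real.rpow_nonneg (by linarith) _) hK))
      (A := incr W s u (Y s)) (A' := incr W s u (Z s))
      (hYR s hsm) (hYR u hum) (hZR s hsm) (hZR u hum)
      ((hYc s u hs0 hsu hum.2).trans (mul_le_mul (by simp only [c]; linarith) hω₁
        (Real.rpow_nonneg (by linarith) _) (by positivity)))
      ((hZc s u hs0 hsu hum.2).trans (mul_le_mul (by simp only [c]; linarith) hω₁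
        (Real.rpow_nonneg (by linarith) _) (by positivity)))
      ((hZr s u hs0 hsu hum.2).trans (mul_le_mul (by simp only [c]; linarith) hω₁'
        (Real.rpow_nonneg (by linarith) _) (by positivity)))
      (hsupN s has (by linarith)) (hsupN u (by linarith) (by linarith))
      (hinc.1.trans (mul_le_mul_of_nonneg_left hω₁ hN))
      (hinc.2.trans (mul_le_mul_of_nonneg_left hω₁' hN))
    rw [three _ (by linarith)]
    refine le_of_eq_of_le ?_ key
    rw [norm_sub_rev]
    congr 1
    have e := germ_defect_eq hW Y hsm hum htm
    have e' := germ_defect_eq hW Z hsm hum htm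
    rw [← neg_eq_iff_eq_neg] at e e'
    rw [← e, ← e']
    abel
  intro s t has hst htb
  have hs0 : 0 ≤ s := ha.trans has
  have htT : t ≤ T := htb.trans hb
  have hsm : s ∈ Icc 0 T := ⟨hs0, by linarith⟩
  have hω : 0 ≤ (t - s) ^ α := Real.rpow_nonneg (by linarith) _
  have hη : 0 ≤ (b - a) ^ α := Real.rpow_nonneg (by linarith) _
  have hωη : (t - s) ^ α ≤ (b - a) ^ α :=
    Real.rpow_le_rpow (by linarith) (by linarith) hα0.le
  have hη1 : (b - a) ^ α ≤ 1 := Real.rpow_le_one (by linarith) hab hα0.le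
  obtain ⟨hf, hfK⟩ := hWK s t hs0 hst htT
  obtain ⟨hg, hgK⟩ := hWWK s t hs0 hst htT
  have sew := HasSewingLimit.norm_sub_le
    ((hY.hasSewingLimit hs0 hst.le htT).sub (hZ.hasSewingLimit hs0 hst.le htT)) hst hθ
    (mul_nonneg hD hN) (fun u v hsu huv hvt => hdefect u v (has.trans hsu) huv (hvt.trans htb))
  have hWd : ‖incr W s t (Y s) - incr W s t (Z s)‖ ≤ K * (t - s) ^ α * (N * (b - a) ^ α) := by
    refine ((convex_closedBall (0 : V) R).norm_image_sub_le_of_norm_fderiv_le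
      (fun v _ => hf.differentiable v)
      (fun v hv => norm_iteratedFDeriv_one (𝕜 := ℝ) (f := incr W s t) (x := v) ▸
        hfK 1 (by norm_num) v (mem_closedBall_zero_iff.1 hv))
      (mem_closedBall_zero_iff.2 (hZR s hsm)) (mem_closedBall_zero_iff.2 (hYR s hsm))).trans ?_
    exact mul_le_mul (mul_le_mul_of_nonneg_right (by simp [K, hK₂]) hω)
      (hsup s has (by linarith)) (norm_nonneg _) (by positivity)
  have hWWd : ‖WW s t (Y s) (Y s) - WW s t (Z s) (Z s)‖
      ≤ K * ((t - s) ^ α) ^ 2 * (2 * (N * (b - a) ^ α)) := by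
    refine (norm_diag_sub_diag_le (g := onProd WW s t) hg hgK (hYR s hsm) (hZR s hsm)).trans ?_
    rw [two _ (by linarith)]
    exact mul_le_mul (mul_le_mul_of_nonneg_right (by simp [K, hK₁]) (by positivity))
      (mul_le_mul_of_nonneg_left (hsup s has (by linarith)) zero_le_two) (by positivity)
      (by positivity)
  rw [three _ (by linarith)] at sew
  rw [two _ (by linarith)]
  generalize (t - s) ^ α = ω at *
  generalize (b - a) ^ α = η at *
  have hrem : ‖(Y t - Y s - incr W s t (Y s)) - (Z t - Z s - incr W s t (Z s))‖
      ≤ (D / q + 2 * K) * η * N * ω ^ 2 := by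
    have e : (Y t - Y s - incr W s t (Y s)) - (Z t - Z s - incr W s t (Z s))
        = (Y t - Y s - (Z t - Z s) - ((incr W s t (Y s) + WW s t (Y s) (Y s))
          - (incr W s t (Z s) + WW s t (Z s) (Z s))))
          + (WW s t (Y s) (Y s) - WW s t (Z s) (Z s)) := by abel
    rw [e]
    calc _ ≤ D * N / q * ω ^ 3 + K * ω ^ 2 * (2 * (N * η)) :=
          (norm_add_le _ _).trans (add_le_add sew hWWd)
      _ = D * N / q * (ω ^ 2 * ω) + K * ω ^ 2 * (2 * (N * η)) := by ring
      -- The order `3α` exceeds the required `2α` by one factor `ω ≤ η`, which supplies the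
      -- smallness.
      _ ≤ D * N / q * (ω ^ 2 * η) + K * ω ^ 2 * (2 * (N * η)) := by gcongr
      _ = _ := by ring
  refine ⟨?_, hrem.trans ?_⟩
  · have e : (Y t - Y s) - (Z t - Z s)
        = ((Y t - Y s - incr W s t (Y s)) - (Z t - Z s - incr W s t (Z s)))
          + (incr W s t (Y s) - incr W s t (Z s)) := by abel
    rw [e]
    calc _ ≤ (D / q + 2 * K) * η * N * ω ^ 2 + K * ω * (N * η) :=
          (norm_add_le _ _).trans (add_le_add hrem hWd)
      _ = (D / q + 2 * K) * η * N * (ω * ω) + K * ω * (N * η) := by ring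
      _ ≤ (D / q + 2 * K) * η * N * (1 * ω) + K * ω * (N * η) := by
          gcongr
          exact hωη.trans hη1
      _ = _ := by ring
  · gcongr
    norm_num

end Uniqueness

end NonlinearRough

/-! ### Propagation from short intervals to `[0,T]`. -/

open NonlinearRough in
theorem NonlinearRough.IsSolution.unique {V : Type*} [NormedAddCommGroup V] [NormedSpace ℝ V]
    {T α : ℝ} (hα : 1 / 3 < α) {β : ℕ → ℝ} {W : ℝ → V → V} {WW : ℝ → ℝ → V → V → V}
    (hW : IsNonlinearRoughPath T α 3 β W WW) {ξ : V} {Y Z : ℝ → V}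
    (hY : IsSolution T α W WW ξ Y) (hZ : IsSolution T α W WW ξ Z) :
    ∀ t ∈ Icc 0 T, Y t = Z t := by
  obtain ⟨C, hC, hcon⟩ := exists_differenceBound_contraction hα hW hY hZ
  obtain ⟨N, hN, hN₀⟩ := hY.controlled.exists_differenceBound hZ.controlled
  obtain ⟨h, h0, h1, hCh⟩ := exists_pos_mul_rpow_le_half (by linarith : 0 < α) C
  -- The length `h` depends only on `C` and `α`, not on the starting point `a`, so the grid `n * h`
  -- exhausts `[0,T]`.
  have step : ∀ a ∈ Icc 0 T, Y a = Z a → ∀ t ∈ Icc a (min (a + h) T), Y t = Z t := by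
    intro a ha hYZ t ht
    have hb : min (a + h) T - a ≤ h := by linarith [min_le_left (a + h) T]
    have hb0 : 0 ≤ min (a + h) T - a := by linarith [ht.1, ht.2]
    refine eq_of_differenceBound_contraction hN hYZ
      (hN₀.mono ha.1 (min_le_right _ _) le_rfl) (fun N hN hb' => ?_) ht.1 ht.2
    refine (hcon a _ N ha.1 (min_le_right _ _) (hb.trans h1) hN hYZ hb').mono le_rfl le_rfl ?_
    refine mul_le_mul_of_nonneg_right (le_trans ?_ hCh) hN
    exact mul_le_mul_of_nonneg_left (Real.rpow_le_rpow hb0 hb (by linarith)) hC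
  have all : ∀ n : ℕ, ∀ t ∈ Icc 0 T, t ≤ n * h → Y t = Z t := by
    intro n
    induction n with
    | zero =>
      intro t ht htn
      obtain rfl : t = 0 := le_antisymm (by simpa using htn) ht.1
      rw [hY.initial, hZ.initial]
    | succ n ih =>
      intro t ht htn
      push_cast at htn
      rcases le_total t (n * h) with htn' | htn'
      · exact ih t ht htn'
      · have hn : (n : ℝ) * h ∈ Icc 0 T := ⟨by positivity, htn'.trans ht.2⟩
        exact step _ hn (ih _ hn le_rfl) t ⟨htn', le_min (by linarith) ht.2⟩
  intro t ht
  obtain ⟨n, hn⟩ := exists_nat_ge (t / h)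
  exact all n t ht ((div_le_iff₀ h0).1 hn)

theorem theorem4p2 {V : Type*} [NormedAddCommGroup V] [NormedSpace ℝ V] [CompleteSpace V]
    [TopologicalSpace.SeparableSpace V] (α : ℝ) (hα : α ∈ Set.Ioc (1 / 3 : ℝ) (1 / 2))
    (β : ℕ → ℝ) (hβ : ∀ k ≤ 3, 0 ≤ β k) (T : ℝ) (hT : 0 ≤ T)
    (W : ℝ → V → V) (WW : ℝ → ℝ → V → V → V)
    (hW : NonlinearRough.IsNonlinearRoughPath T α 3 β W WW)
    (ξ : V) (Y Z : ℝ → V) (hY : NonlinearRough.IsSolution T α W WW ξ Y)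
    (hZ : NonlinearRough.IsSolution T α W WW ξ Z) :
    ∀ t ∈ Set.Icc 0 T, Y t = Z t := by
  exact hY.unique hα.1 hW hZ
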